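/- Let $n\ge 1$, let $D\subset\mathbb R^n$ be open and bounded, let $1<p<\infty$, and put $\bar q=\frac{np}{n-p}$ if $p<n$ and $\bar q=\infty$ if $p\ge n$. Functions in $W^{1,p}_0(D)$ are complex-valued; for $1\le q\le\infty$ let $$K_{q,p}=\sup\Big\{\frac{\|v\|_{L^q(D)}}{\|\nabla v\|_{L^p(D)}} : v\in W^{1,p}_0(D),\ v\neq 0\Big\}$$ be the Sobolev constant of $W^{1,p}_0(D)\to L^q(D)$. Let $\beta\ge -1$, $\gamma\ge 0$ and $1\le r\le\infty$, let $V\in L^r(D)$ be real-valued, and let $f:D\times\mathbb C\times\mathbb C^n\to\mathbb C$ satisfy $$|f(x,y,z)|\le |y|^{\beta+1}|z|^{\gamma}$$ for all $x\in D$, $y\in\mathbb C$, $z\in\mathbb C^n$ (with $0^0=1$). Let $u\in W^{1,p}_0(D)$, $u\not\equiv 0$, be a weak solution of $-\Delta_p u=V(x)f(x,u,\nabla u)$, that is, $Vf(\cdot,u,\nabla u)$ is locally integrable on $D$ and $$\int_D|\nabla u|^{p-2}\nabla u\cdot\nabla\psi\,dx=\int_D V(x)f(x,u,\nabla u)\,\psi\,dx\qquad\text{for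 all }\psi\in C_0^\infty(D).$$ (i) If $p\ne n$ and $\frac1r+\frac{\beta+2}{\bar q}+\frac{\gamma}{p}=1$, then $K_{\bar q,p}<\infty$, $u\in L^{\bar q}(D)$, and $$K_{\bar q,p}^{\,p-\gamma}\,\|V\|_{L^r(D)}\,\|u\|_{L^{\bar q}(D)}^{\,2+\beta-p+\gamma}\ge 1.$$ (ii) If $p=n$, $1\le q<\infty$ and $\frac1r+\frac{\beta+2}{q}+\frac{\gamma}{p}=1$, then $K_{q,p}<\infty$, $u\in L^{q}(D)$, and $$K_{q,p}^{\,p-\gamma}\,\|V\|_{L^r(D)}\,\|u\|_{L^{q}(D)}^{\,2+\beta-p+\gamma}\ge 1.$$ -/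

import Mathlib

open MeasureTheory Filter Topology
open scoped ContDiff ENNReal

namespace PLap

/-- The classical gradient `(∂₁ψ, …, ∂ₙψ)` of a complex-valued function on `ℝⁿ`. -/
noncomputable def grad {n : ℕ} (ψ : EuclideanSpace ℝ (Fin n) → ℂ)
    (x : EuclideanSpace ℝ (Fin n)) : EuclideanSpace ℂ (Fin n) :=
  WithLp.toLp 2 (fun i => fderiv ℝ ψ x (EuclideanSpace.single i 1))

/-- `ψ ∈ C₀^∞(D)`: smooth, complex-valued, with compact support contained in `D`. -/
structure IsTestFunction {n : ℕ} (D : Set (EuclideanSpace ℝ (Fin n)))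
    (ψ : EuclideanSpace ℝ (Fin n) → ℂ) : Prop where
  smooth : ContDiff ℝ ∞ ψ
  compact : HasCompactSupport ψ
  supp : tsupport ψ ⊆ D

/-- `g` is the weak (distributional) gradient of `u` on `D`. -/
structure IsWeakGradient {n : ℕ} (D : Set (EuclideanSpace ℝ (Fin n)))
    (u : EuclideanSpace ℝ (Fin n) → ℂ)
    (g : EuclideanSpace ℝ (Fin n) → EuclideanSpace ℂ (Fin n)) : Prop where
  locInt_fun : LocallyIntegrableOn u D volume
  locInt_grad : LocallyIntegrableOn g D volume
  byParts : ∀ ψ, IsTestFunction D ψ → ∀ i : Fin n,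
    ∫ x in D, u x * grad ψ x i = - ∫ x in D, g x i * ψ x

/-- `u ∈ W₀^{1,p}(D)` with `∇u = g`: `u` and its weak gradient `g` are in `L^p(D)`, and
`u` is a limit in the norm of `W^{1,p}(D)` of functions of class `C₀^∞(D)`.
Only the values of `u` and `g` almost everywhere in `D` matter. -/
structure MemW0 {n : ℕ} (p : ℝ) (D : Set (EuclideanSpace ℝ (Fin n)))
    (u : EuclideanSpace ℝ (Fin n) → ℂ)
    (g : EuclideanSpace ℝ (Fin n) → EuclideanSpace ℂ (Fin n)) : Prop where
  memLp_fun : MemLp u (ENNReal.ofReal p) (volume.restrict D)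
  memLp_grad : MemLp g (ENNReal.ofReal p) (volume.restrict D)
  weakGrad : IsWeakGradient D u g
  approx : ∃ ψ : ℕ → EuclideanSpace ℝ (Fin n) → ℂ, (∀ k, IsTestFunction D (ψ k)) ∧
    Tendsto (fun k => eLpNorm (fun x => ψ k x - u x) (ENNReal.ofReal p) (volume.restrict D))
      atTop (𝓝 0) ∧
    Tendsto (fun k => eLpNorm (fun x => grad (ψ k) x - g x) (ENNReal.ofReal p)
      (volume.restrict D)) atTop (𝓝 0)

/-- `u` does not vanish almost everywhere in `D`. -/
def Nontriv {n : ℕ} (D : Set (EuclideanSpace ℝ (Fin n)))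
    (u : EuclideanSpace ℝ (Fin n) → ℂ) : Prop :=
  ¬ (u =ᵐ[volume.restrict D] 0)

/-- The Sobolev constant `K_{q,p} = sup_{u ≠ 0} ‖u‖_q / ‖∇u‖_p` of `W₀^{1,p}(D) → L^q(D)`,
as an element of `[0, ∞]`. -/
noncomputable def sobolevConst {n : ℕ} (q : ℝ≥0∞) (p : ℝ)
    (D : Set (EuclideanSpace ℝ (Fin n))) : ℝ≥0∞ :=
  ⨆ (u : EuclideanSpace ℝ (Fin n) → ℂ)
    (g : EuclideanSpace ℝ (Fin n) → EuclideanSpace ℂ (Fin n))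
    (_ : MemW0 p D u g) (_ : Nontriv D u),
    eLpNorm u q (volume.restrict D) / eLpNorm g (ENNReal.ofReal p) (volume.restrict D)

/-- The critical exponent `q̄`: `np/(n-p)` if `p < n`, and `∞` if `p ≥ n`. -/
noncomputable def qBar (n : ℕ) (p : ℝ) : ℝ≥0∞ :=
  if p < n then ENNReal.ofReal (n * p / (n - p)) else ⊤

/-- `u ∈ W₀^{1,p}(D)`, with `∇u = g`, is a weak solution of `-Δ_p u = V(x) f(x, u, ∇u)`:
the right-hand side is locally integrable on `D`, and for all `ψ ∈ C₀^∞(D)`,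
`∫_D |∇u|^{p-2} ∇u · ∇ψ = ∫_D V f(x, u, ∇u) ψ`, where the dot product is bilinear. -/
structure IsWeakSolution {n : ℕ} (p : ℝ) (D : Set (EuclideanSpace ℝ (Fin n)))
    (V : EuclideanSpace ℝ (Fin n) → ℝ)
    (f : EuclideanSpace ℝ (Fin n) → ℂ → EuclideanSpace ℂ (Fin n) → ℂ)
    (u : EuclideanSpace ℝ (Fin n) → ℂ)
    (g : EuclideanSpace ℝ (Fin n) → EuclideanSpace ℂ (Fin n)) : Prop where
  mem : MemW0 p D u g
  locInt : LocallyIntegrableOn (fun x => (V x : ℂ) * f x (u x) (g x)) D volume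
  eqn : ∀ ψ, IsTestFunction D ψ →
    ∫ x in D, ((‖g x‖ ^ (p - 2) : ℝ) : ℂ) * ∑ i, g x i * grad ψ x i
      = ∫ x in D, (V x : ℂ) * f x (u x) (g x) * ψ x

end PLap

/-! Test the equation against `u` itself: Hölder's inequality, with exponents matched by the scaling
relation, gives `‖∇u‖_p^p ≤ ‖V‖_r ‖u‖_q^(β+2) ‖∇u‖_p^γ`. Cancelling `‖∇u‖_p^γ` and inserting `‖u‖_q
≤ K ‖∇u‖_p` yields the lower bound (`one_le_of_energy_le`).

Only smooth test functions are admissible, so `IsWeakSolution.energy_le` tests with the conjugate of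
some `ψ` in `C₀^∞(D)` and keeps an error controlled by `‖∇u - ∇ψ‖_p`. The limit along approximants
needs `ψ → u` in `L^q` as well; `MemW0.exists_approx` obtains this from a Sobolev inequality with
some finite constant. That inequality is Gagliardo–Nirenberg–Sobolev for `p < n`, the same at a
lower exponent followed by Hölder on bounded `D` for `p = n`, and a Morrey-type estimate
(`exists_enorm_le_eLpNorm_fderiv`) for `p > n`. -/

namespace PLap

open scoped NNReal

/-! ### Morrey-type sup bound for `p > n` -/

/-- A scaled translate of a function has the expected `L^p` norm. -/
lemma eLpNorm_comp_add_smul {n : ℕ} {F : Type*} [NormedAddCommGroup F]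
    {h : EuclideanSpace ℝ (Fin n) → F} (hh : Continuous h) {p : ℝ} (hp : 0 < p)
    (x : EuclideanSpace ℝ (Fin n)) {t : ℝ} (ht : 0 < t) :
    eLpNorm (fun z => h (x + t • z)) (ENNReal.ofReal p) volume
      = ENNReal.ofReal (t ^ (-(n / p))) * eLpNorm h (ENNReal.ofReal p) volume := by
  have h1 : eLpNorm (fun z => h (x + t • z)) (ENNReal.ofReal p) volume
      = eLpNorm (fun y => h (x + y)) (ENNReal.ofReal p)
        (Measure.map (fun z : EuclideanSpace ℝ (Fin n) => t • z) volume) := by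
    rw [eLpNorm_map_measure]
    · rfl
    · exact (by fun_prop : Continuous fun y => h (x + y)).aestronglyMeasurable
    · fun_prop
  rw [h1, Measure.map_addHaar_smul volume ht.ne',
    eLpNorm_smul_measure_of_ne_top ENNReal.ofReal_ne_top, smul_eq_mul]
  congr 1
  · rw [finrank_euclideanSpace_fin, abs_of_pos (by positivity),
      ENNReal.ofReal_rpow_of_pos (by positivity)]
    congr 1
    rw [one_div, ENNReal.toReal_inv, ENNReal.toReal_ofReal hp.le, ← Real.rpow_natCast,
      ← Real.rpow_neg ht.le, ← Real.rpow_mul ht.le]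
    congr 1
    ring
  · exact eLpNorm_comp_measurePreserving (g := h) hh.aestronglyMeasurable
      (measurePreserving_add_left volume x)

/-- Fundamental theorem of calculus along a segment, as a bound. -/
lemma enorm_sub_le_lintegral_fderiv {n : ℕ} {F : Type*} [NormedAddCommGroup F] [NormedSpace ℝ F]
    [CompleteSpace F] {ψ : EuclideanSpace ℝ (Fin n) → F} (hψ : ContDiff ℝ 1 ψ)
    (x z : EuclideanSpace ℝ (Fin n)) :
    ‖ψ (x + z) - ψ x‖ₑ ≤ ∫⁻ t in Set.Ioc (0 : ℝ) 1, ‖fderiv ℝ ψ (x + t • z)‖ₑ * ‖z‖ₑ := by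
  have hc : Continuous (fderiv ℝ ψ) := hψ.continuous_fderiv one_ne_zero
  have hd : ∀ t : ℝ, HasDerivAt (fun t : ℝ => ψ (x + t • z)) (fderiv ℝ ψ (x + t • z) z) t := by
    intro t
    have h1 : HasDerivAt (fun t : ℝ => x + t • z) z t := by
      simpa using ((hasDerivAt_id t).smul_const z).const_add x
    exact ((hψ.differentiable one_ne_zero _).hasFDerivAt).comp_hasDerivAt t h1
  have h2 := intervalIntegral.integral_eq_sub_of_hasDerivAt (a := 0) (b := 1) (fun t _ => hd t)
    (Continuous.intervalIntegrable (by fun_prop) _ _)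
  simp only [one_smul, zero_smul, add_zero] at h2
  rw [← h2, intervalIntegral.integral_of_le zero_le_one]
  refine (enorm_integral_le_lintegral_enorm _).trans (lintegral_mono fun t => ?_)
  exact ContinuousLinearMap.le_opENorm _ _

/-- The embedding `W_0^{1,p} → L^∞` for `p > n`, on smooth functions supported in a ball. -/
theorem exists_enorm_le_eLpNorm_fderiv {n : ℕ} (hn : 1 ≤ n) {p : ℝ} (hp : (n : ℝ) < p)
    {R : ℝ} (hR : 0 < R) :
    ∃ C : ℝ≥0, ∀ ψ : EuclideanSpace ℝ (Fin n) → ℂ, ContDiff ℝ 1 ψ →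
      Function.support ψ ⊆ Metric.ball 0 R →
      ∀ x, ‖ψ x‖ₑ ≤ C * eLpNorm (fderiv ℝ ψ) (ENNReal.ofReal p) volume := by
  have hn' : (1 : ℝ) ≤ n := by exact_mod_cast hn
  have hp0 : 0 < p := by linarith
  -- For `x` in the ball of radius `R` about 0 and `z ∈ B`, `2R < ‖z‖ < 4R`, so `x + z` lies outside
  -- the support. Thus `ψ x` is an integral of the derivative along the segment to `x + z`, and one
  -- averages over `z ∈ B`.
  set c : EuclideanSpace ℝ (Fin n) := EuclideanSpace.single ⟨0, hn⟩ (3 * R) with hc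
  have hcn : ‖c‖ = 3 * R := by simp [hc, abs_of_pos hR]
  set B := Metric.ball c R with hB
  have hB0 : volume B ≠ 0 := (Metric.measure_ball_pos volume c hR).ne'
  have hB1 : volume B ≠ ⊤ := measure_ball_lt_top.ne
  set I : ℝ≥0∞ := ∫⁻ t in Set.Ioc (0 : ℝ) 1, ENNReal.ofReal (t ^ (-(n / p))) with hI
  have hI1 : I ≠ ⊤ := by
    have h1 : IntervalIntegrable (fun t : ℝ => t ^ (-(n / p))) volume 0 1 := by
      apply intervalIntegral.intervalIntegrable_rpow'
      -- Here `p > n` enters: `t^(-n/p)` is integrable at 0.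
      rw [neg_lt_neg_iff, div_lt_one hp0]
      exact hp
    rw [intervalIntegrable_iff_integrableOn_Ioc_of_le zero_le_one] at h1
    have h2 := h1.lintegral_lt_top
    exact h2.ne
  set A : ℝ≥0∞ := volume B ^ (1 / (1 : ℝ≥0∞).toReal - 1 / (ENNReal.ofReal p).toReal) with hA
  have hA1 : A ≠ ⊤ := by
    refine ENNReal.rpow_ne_top_of_ne_zero hB0 hB1
  set K : ℝ≥0∞ := I * A * ENNReal.ofReal (4 * R) / volume B with hK
  have hK1 : K ≠ ⊤ := by
    refine ENNReal.div_ne_top ?_ hB0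
    exact ENNReal.mul_ne_top (ENNReal.mul_ne_top hI1 hA1) ENNReal.ofReal_ne_top
  refine ⟨K.toNNReal, fun ψ hψ hsupp x => ?_⟩
  rw [ENNReal.coe_toNNReal hK1]
  set N := eLpNorm (fderiv ℝ ψ) (ENNReal.ofReal p) volume with hN
  by_cases hx : x ∈ Metric.ball (0 : EuclideanSpace ℝ (Fin n)) R
  swap
  · have : ψ x = 0 := by
      by_contra h
      exact hx (hsupp h)
    simp [this]
  have hcd : Continuous (fderiv ℝ ψ) := hψ.continuous_fderiv one_ne_zero
  have hz : ∀ z ∈ B, ‖ψ x‖ₑ ≤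
      ∫⁻ t in Set.Ioc (0 : ℝ) 1, ‖fderiv ℝ ψ (x + t • z)‖ₑ * ENNReal.ofReal (4 * R) := by
    intro z hz
    rw [hB, Metric.mem_ball, dist_eq_norm] at hz
    rw [Metric.mem_ball, dist_zero_right] at hx
    have hzl : ‖z‖ < 4 * R := by
      have := norm_add_le (z - c) c
      rw [sub_add_cancel] at this
      linarith
    have hzr : 2 * R < ‖z‖ := by
      have := norm_sub_norm_le c z
      rw [norm_sub_rev] at this
      linarith
    have h0 : ψ (x + z) = 0 := by
      by_contra h
      have h1 := hsupp h
      rw [Metric.mem_ball, dist_zero_right] at h1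
      have h2 := norm_sub_le (x + z) x
      rw [add_sub_cancel_left] at h2
      linarith
    have h3 := enorm_sub_le_lintegral_fderiv hψ x z
    rw [h0, zero_sub, enorm_neg] at h3
    refine h3.trans (lintegral_mono fun t => ?_)
    gcongr
    rw [← ofReal_norm]
    exact ENNReal.ofReal_le_ofReal hzl.le
  -- At fixed `t`: Hölder on `B`, then the change of variables `y = x + t z`.
  have hslice : ∀ t ∈ Set.Ioc (0 : ℝ) 1, ∫⁻ z in B, ‖fderiv ℝ ψ (x + t • z)‖ₑ
      ≤ ENNReal.ofReal (t ^ (-(n / p))) * N * A := by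
    intro t ht
    have hm : Continuous fun z => fderiv ℝ ψ (x + t • z) := by fun_prop
    have h1 := eLpNorm_le_eLpNorm_mul_rpow_measure_univ (μ := volume.restrict B) (p := 1)
      (q := ENNReal.ofReal p) (by simpa using by linarith) hm.aestronglyMeasurable
    rw [eLpNorm_one_eq_lintegral_enorm, Measure.restrict_apply_univ] at h1
    refine h1.trans ?_
    gcongr
    refine (eLpNorm_mono_measure _ Measure.restrict_le_self).trans ?_
    rw [eLpNorm_comp_add_smul hcd hp0 x ht.1]
  have hmain : ‖ψ x‖ₑ * volume B ≤ I * A * ENNReal.ofReal (4 * R) * N := by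
    calc ‖ψ x‖ₑ * volume B = ∫⁻ z in B, ‖ψ x‖ₑ := by rw [setLIntegral_const]
      _ ≤ ∫⁻ z in B, ∫⁻ t in Set.Ioc (0 : ℝ) 1,
            ‖fderiv ℝ ψ (x + t • z)‖ₑ * ENNReal.ofReal (4 * R) :=
          setLIntegral_mono' measurableSet_ball hz
      _ = ∫⁻ t in Set.Ioc (0 : ℝ) 1, ∫⁻ z in B,
            ‖fderiv ℝ ψ (x + t • z)‖ₑ * ENNReal.ofReal (4 * R) := by
          apply lintegral_lintegral_swap
          refine Continuous.aemeasurable ?_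
          refine Continuous.comp (g := fun a : ℝ≥0∞ => a * ENNReal.ofReal (4 * R))
            (ENNReal.continuous_mul_const ENNReal.ofReal_ne_top) ?_
          exact (by fun_prop : Continuous fun q : EuclideanSpace ℝ (Fin n) × ℝ =>
            fderiv ℝ ψ (x + q.2 • q.1)).enorm
      _ ≤ ∫⁻ t in Set.Ioc (0 : ℝ) 1,
            ENNReal.ofReal (t ^ (-(n / p))) * (N * A * ENNReal.ofReal (4 * R)) := by
          refine setLIntegral_mono' measurableSet_Ioc fun t ht => ?_
          rw [lintegral_mul_const' _ _ ENNReal.ofReal_ne_top, ← mul_assoc, ← mul_assoc]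
          gcongr
          exact hslice t ht
      _ = I * A * ENNReal.ofReal (4 * R) * N := by
          rw [lintegral_mul_const]
          · ring
          · fun_prop
  rw [hK, div_eq_mul_inv, mul_right_comm, ← div_eq_mul_inv,
    ENNReal.le_div_iff_mul_le (Or.inl hB0) (Or.inl hB1)]
  exact hmain

/-! ### Gradients and test functions -/

/-- Cauchy–Schwarz in coordinates. It transfers Sobolev estimates stated with `fderiv` to `grad`. -/
lemma norm_fderiv_le_norm_grad {n : ℕ} (ψ : EuclideanSpace ℝ (Fin n) → ℂ)
    (x : EuclideanSpace ℝ (Fin n)) : ‖fderiv ℝ ψ x‖ ≤ ‖grad ψ x‖ := by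
  refine ContinuousLinearMap.opNorm_le_bound _ (norm_nonneg _) fun v => ?_
  have hv : v = ∑ i, v i • EuclideanSpace.single i (1 : ℝ) := by
    ext j
    simp [Finset.sum_apply, Pi.single_apply]
  calc ‖fderiv ℝ ψ x v‖ = ‖∑ i, v i • grad ψ x i‖ := by
        conv_lhs => rw [hv]
        simp [grad]
    _ ≤ ∑ i, ‖grad ψ x i‖ * ‖v i‖ := by
        refine (norm_sum_le _ _).trans (Finset.sum_le_sum fun i _ => ?_)
        rw [norm_smul, mul_comm]
    _ ≤ √(∑ i, ‖grad ψ x i‖ ^ 2) * √(∑ i, ‖v i‖ ^ 2) := Real.sum_mul_le_sqrt_mul_sqrt _ _ _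
    _ = ‖grad ψ x‖ * ‖v‖ := by rw [EuclideanSpace.norm_eq, EuclideanSpace.norm_eq]

lemma grad_sub {n : ℕ} {ψ φ : EuclideanSpace ℝ (Fin n) → ℂ} (hψ : Differentiable ℝ ψ)
    (hφ : Differentiable ℝ φ) (x : EuclideanSpace ℝ (Fin n)) :
    grad (fun y => ψ y - φ y) x = grad ψ x - grad φ x := by
  ext i
  simp [grad, fderiv_fun_sub (hψ x) (hφ x)]

lemma grad_conj {n : ℕ} (ψ : EuclideanSpace ℝ (Fin n) → ℂ) (hψ : Differentiable ℝ ψ)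
    (x : EuclideanSpace ℝ (Fin n)) (i : Fin n) :
    grad (fun y => starRingEnd ℂ (ψ y)) x i = starRingEnd ℂ (grad ψ x i) := by
  have h : HasFDerivAt (fun y => Complex.conjCLE (ψ y))
      ((Complex.conjCLE : ℂ →L[ℝ] ℂ).comp (fderiv ℝ ψ x)) x :=
    (Complex.conjCLE : ℂ →L[ℝ] ℂ).hasFDerivAt.comp x (hψ x).hasFDerivAt
  have h' := h.fderiv
  simp only [Complex.conjCLE_apply] at h'
  simp [grad, h']

variable {n : ℕ} {D : Set (EuclideanSpace ℝ (Fin n))}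

lemma IsTestFunction.differentiable {ψ : EuclideanSpace ℝ (Fin n) → ℂ}
    (hψ : IsTestFunction D ψ) : Differentiable ℝ ψ := hψ.smooth.differentiable (by simp)

lemma IsTestFunction.sub {ψ φ : EuclideanSpace ℝ (Fin n) → ℂ}
    (hψ : IsTestFunction D ψ) (hφ : IsTestFunction D φ) :
    IsTestFunction D (fun x => ψ x - φ x) where
  smooth := hψ.smooth.sub hφ.smooth
  compact := hψ.compact.sub hφ.compact
  supp := (tsupport_sub ψ φ).trans (Set.union_subset hψ.supp hφ.supp)

lemma IsTestFunction.conj {ψ : EuclideanSpace ℝ (Fin n) → ℂ} (hψ : IsTestFunction D ψ) :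
    IsTestFunction D (fun x => starRingEnd ℂ (ψ x)) where
  smooth := Complex.conjCLE.contDiff.comp hψ.smooth
  compact := hψ.compact.comp_left (g := starRingEnd ℂ) (map_zero _)
  supp := (tsupport_comp_subset (g := starRingEnd ℂ) (map_zero _) ψ).trans hψ.supp

lemma IsTestFunction.continuous_grad {ψ : EuclideanSpace ℝ (Fin n) → ℂ}
    (hψ : IsTestFunction D ψ) : Continuous (grad ψ) := by
  have h : Continuous (fderiv ℝ ψ) := hψ.smooth.continuous_fderiv (by simp)
  unfold grad
  exact (PiLp.continuous_toLp 2 _).comp (by fun_prop)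

lemma IsTestFunction.eLpNorm_restrict {ψ : EuclideanSpace ℝ (Fin n) → ℂ}
    (hψ : IsTestFunction D ψ) (q : ℝ≥0∞) :
    eLpNorm ψ q (volume.restrict D) = eLpNorm ψ q volume :=
  eLpNorm_restrict_eq_of_support_subset (subset_tsupport ψ |>.trans hψ.supp)

lemma IsTestFunction.eLpNorm_fderiv_le {ψ : EuclideanSpace ℝ (Fin n) → ℂ}
    (hψ : IsTestFunction D ψ) (p : ℝ≥0∞) :
    eLpNorm (fderiv ℝ ψ) p volume ≤ eLpNorm (grad ψ) p (volume.restrict D) := by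
  rw [← eLpNorm_restrict_eq_of_support_subset (s := D) (f := fderiv ℝ ψ)
    ((support_fderiv_subset ℝ).trans hψ.supp)]
  exact eLpNorm_mono (norm_fderiv_le_norm_grad ψ)

/-! ### Sobolev inequalities for test functions -/

/-- The Sobolev inequality with constant `C` for test functions. -/
def SobolevBound (C : ℝ≥0) (q : ℝ≥0∞) (p : ℝ) (D : Set (EuclideanSpace ℝ (Fin n))) : Prop :=
  ∀ ψ, IsTestFunction D ψ →
    eLpNorm ψ q (volume.restrict D)
      ≤ C * eLpNorm (grad ψ) (ENNReal.ofReal p) (volume.restrict D)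

lemma exists_sobolevBound_of_lt {p : ℝ} (hp : 1 < p) (hpn : p < n) :
    ∃ C, SobolevBound C (ENNReal.ofReal (n * p / (n - p))) p D := by
  refine ⟨SNormLESNormFDerivOfEqConst ℂ
    (volume : Measure (EuclideanSpace ℝ (Fin n))) p.toNNReal, fun ψ hψ => ?_⟩
  rw [hψ.eLpNorm_restrict]
  have hnp : 0 < (n : ℝ) - p := by linarith
  have hn : (0 : ℝ) < n := by linarith
  refine (eLpNorm_le_eLpNorm_fderiv_of_eq (F := ℂ) volume (hψ.smooth.of_le (by simp)) hψ.compact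
    (p := p.toNNReal) (p' := (n * p / (n - p)).toNNReal) (by simpa using hp.le)
    (by simpa using hn) ?_).trans ?_
  · rw [Real.coe_toNNReal _ (by positivity), NNReal.coe_inv, Real.coe_toNNReal _ (by positivity),
      finrank_euclideanSpace_fin]
    field_simp
  · gcongr
    exact hψ.eLpNorm_fderiv_le _

/-- Apply the subcritical inequality at some `s < n` whose Sobolev conjugate is at least `q`, then
pass from `L^s` to `L^n` by Hölder, as `D` has finite measure. -/
lemma exists_sobolevBound_of_eq (hDb : Bornology.IsBounded D) (hn : 1 < n)
    {q : ℝ≥0∞} (hq : 1 ≤ q) (hq' : q < ⊤) : ∃ C, SobolevBound C q n D := by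
  lift q to ℝ≥0 using hq'.ne
  have hq0 : 0 < q := lt_of_lt_of_le one_pos (by exact_mod_cast hq)
  have hnR : (1 : ℝ≥0) < n := by exact_mod_cast hn
  have hn0 : (0 : ℝ≥0) < n := one_pos.trans hnR
  -- The inverse is the exponent whose Sobolev conjugate is exactly `q`; the maximum keeps `s ≥ 1`,
  -- and `n > 1` keeps `s < n`.
  set s : ℝ≥0 := max 1 ((n : ℝ≥0)⁻¹ + q⁻¹)⁻¹ with hs
  have hs1 : 1 ≤ s := le_max_left _ _
  have hsn : s < n := by
    refine max_lt hnR ?_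
    rw [inv_lt_comm₀ (by positivity) hn0]
    exact lt_add_of_pos_right _ (by positivity)
  have hsq : s⁻¹ ≤ (n : ℝ≥0)⁻¹ + q⁻¹ := by
    rw [inv_le_comm₀ (by positivity) (by positivity)]
    exact le_max_right _ _
  set a : ℝ := 1 / (s : ℝ≥0∞).toReal - 1 / (ENNReal.ofReal n).toReal with ha
  have ha0 : 0 ≤ a := by
    rw [ha, sub_nonneg]
    simp only [ENNReal.coe_toReal, ENNReal.ofReal_natCast, ENNReal.toReal_natCast]
    gcongr
    exact_mod_cast hsn.le
  have hA : volume D ^ a ≠ ⊤ := ENNReal.rpow_ne_top_of_nonneg ha0 hDb.measure_lt_top.ne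
  refine ⟨eLpNormLESNormFDerivOfLeConst ℂ volume D s q * (volume D ^ a).toNNReal, fun ψ hψ => ?_⟩
  rw [hψ.eLpNorm_restrict]
  refine (eLpNorm_le_eLpNorm_fderiv_of_le (F := ℂ) volume (hψ.smooth.of_le (by simp))
    (s := D) (subset_tsupport ψ |>.trans hψ.supp) (p := s) (q := q) hs1
    (by rw [finrank_euclideanSpace_fin]; exact_mod_cast hsn) ?_ hDb).trans ?_
  · rw [finrank_euclideanSpace_fin, sub_le_iff_le_add']
    exact_mod_cast hsq
  · rw [ENNReal.coe_mul, mul_assoc]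
    gcongr
    refine (hψ.eLpNorm_fderiv_le _).trans ?_
    rw [ENNReal.coe_toNNReal hA, mul_comm]
    have := eLpNorm_le_eLpNorm_mul_rpow_measure_univ (μ := volume.restrict D) (p := s)
      (q := ENNReal.ofReal n) (by simpa using (by exact_mod_cast hsn.le : (s : ℝ≥0∞) ≤ n))
      hψ.continuous_grad.aestronglyMeasurable
    rwa [Measure.restrict_apply_univ] at this

lemma exists_sobolevBound_of_gt (hDb : Bornology.IsBounded D) (hn : 1 ≤ n) {p : ℝ}
    (hp : (n : ℝ) < p) : ∃ C, SobolevBound C ⊤ p D := by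
  obtain ⟨R, hR, hDR⟩ := hDb.subset_ball_lt 0 0
  obtain ⟨C, hC⟩ := exists_enorm_le_eLpNorm_fderiv hn hp hR
  refine ⟨C, fun ψ hψ => ?_⟩
  rw [eLpNorm_exponent_top]
  refine eLpNormEssSup_le_of_ae_enorm_bound (Eventually.of_forall fun x => ?_)
  refine (hC ψ (hψ.smooth.of_le (by simp))
    ((subset_tsupport ψ |>.trans hψ.supp).trans hDR) x).trans ?_
  gcongr
  exact hψ.eLpNorm_fderiv_le _

/-! ### Hölder inequalities -/

/-- Writing the exponent through its reciprocal `a/q` covers `q = ∞` and `a = 0` uniformly: both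
give `L^∞`. For `a = 0` the function is the constant 1, and the inequality is strict on a null
space. -/
lemma eLpNorm_norm_rpow_inv_le {α F : Type*} [MeasurableSpace α] [NormedAddCommGroup F]
    {μ : Measure α} (h : α → F) {a : ℝ} (ha : 0 ≤ a) (q : ℝ≥0∞) :
    eLpNorm (fun x => ‖h x‖ ^ a) ((ENNReal.ofReal a * q⁻¹)⁻¹) μ ≤ eLpNorm h q μ ^ a := by
  rcases ha.eq_or_lt with rfl | ha
  · simp only [Real.rpow_zero, ENNReal.ofReal_zero, zero_mul, ENNReal.inv_zero,
      ENNReal.rpow_zero, eLpNorm_exponent_top]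
    exact eLpNormEssSup_le_of_ae_enorm_bound (Eventually.of_forall fun x => by simp)
  · rw [eLpNorm_norm_rpow _ ha]
    have h0 : ENNReal.ofReal a ≠ 0 := by simpa using ha
    rw [ENNReal.mul_inv (Or.inl h0) (Or.inl ENNReal.ofReal_ne_top), inv_inv, mul_right_comm,
      ENNReal.inv_mul_cancel h0 ENNReal.ofReal_ne_top, one_mul]

lemma eLpNorm_mul_le_of_inv {α : Type*} [MeasurableSpace α] {μ : Measure α} {a b : α → ℝ}
    (ha : AEStronglyMeasurable a μ) (hb : AEStronglyMeasurable b μ) {p q r : ℝ≥0∞}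
    (h : p⁻¹ + q⁻¹ = r⁻¹) :
    eLpNorm (fun x => a x * b x) r μ ≤ eLpNorm a p μ * eLpNorm b q μ := by
  have : ENNReal.HolderTriple p q r := ⟨h⟩
  have h1 := eLpNorm_smul_le_mul_eLpNorm (p := p) (q := q) (r := r) hb ha
  exact h1

lemma aestronglyMeasurable_norm_rpow {α F : Type*} [MeasurableSpace α] [NormedAddCommGroup F]
    {μ : Measure α} {h : α → F} (hh : AEStronglyMeasurable h μ) (a : ℝ) :
    AEStronglyMeasurable (fun x => ‖h x‖ ^ a) μ :=
  (hh.norm.aemeasurable.pow_const a).aestronglyMeasurable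

/-- Hölder's inequality for the product `|V| |u|^a |g|^b |w|`. -/
lemma eLpNorm_prod_le {α F₁ F₂ F₃ F₄ : Type*} [MeasurableSpace α] [NormedAddCommGroup F₁]
    [NormedAddCommGroup F₂] [NormedAddCommGroup F₃] [NormedAddCommGroup F₄] {μ : Measure α}
    {V : α → F₁} {u : α → F₂} {g : α → F₃} {w : α → F₄} (hV : AEStronglyMeasurable V μ)
    (hu : AEStronglyMeasurable u μ) (hg : AEStronglyMeasurable g μ)
    (hw : AEStronglyMeasurable w μ) {a b : ℝ} (ha : 0 ≤ a) (hb : 0 ≤ b) {r q p s : ℝ≥0∞}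
    (h : r⁻¹ + ENNReal.ofReal a * q⁻¹ + ENNReal.ofReal b * p⁻¹ + s⁻¹ = 1) :
    eLpNorm (fun x => ‖V x‖ * ‖u x‖ ^ a * ‖g x‖ ^ b * ‖w x‖) 1 μ
      ≤ eLpNorm V r μ * eLpNorm u q μ ^ a * eLpNorm g p μ ^ b * eLpNorm w s μ := by
  have hu' := aestronglyMeasurable_norm_rpow hu a
  have hg' := aestronglyMeasurable_norm_rpow hg b
  refine (eLpNorm_mul_le_of_inv ((hV.norm.mul hu').mul hg') hw.norm
    (p := (r⁻¹ + ENNReal.ofReal a * q⁻¹ + ENNReal.ofReal b * p⁻¹)⁻¹) (q := s) ?_).trans ?_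
  · rw [inv_inv, h, inv_one]
  rw [eLpNorm_norm]
  gcongr
  refine (eLpNorm_mul_le_of_inv (hV.norm.mul hu') hg'
    (p := (r⁻¹ + ENNReal.ofReal a * q⁻¹)⁻¹) (q := (ENNReal.ofReal b * p⁻¹)⁻¹) ?_).trans ?_
  · simp only [inv_inv]
  refine mul_le_mul' ?_ (eLpNorm_norm_rpow_inv_le g hb p)
  refine (eLpNorm_mul_le_of_inv hV.norm hu' (p := r) (q := (ENNReal.ofReal a * q⁻¹)⁻¹) ?_).trans ?_
  · simp only [inv_inv]
  rw [eLpNorm_norm]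
  gcongr
  exact eLpNorm_norm_rpow_inv_le u ha q

/-! ### From test functions to `W₀^{1,p}` -/

/-- The Sobolev inequality passes to limits of test functions. -/
lemma SobolevBound.le_of_tendsto {C : ℝ≥0} {q : ℝ≥0∞} {p : ℝ} (hC : SobolevBound C q p D)
    (hp : 1 < p) {φ : ℕ → EuclideanSpace ℝ (Fin n) → ℂ} (hφ : ∀ j, IsTestFunction D (φ j))
    {v : EuclideanSpace ℝ (Fin n) → ℂ} {h : EuclideanSpace ℝ (Fin n) → EuclideanSpace ℂ (Fin n)}
    (hv : AEStronglyMeasurable v (volume.restrict D))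
    (hh : AEStronglyMeasurable h (volume.restrict D))
    (hφv : Tendsto (fun j => eLpNorm (fun x => φ j x - v x) (ENNReal.ofReal p)
      (volume.restrict D)) atTop (𝓝 0))
    (hφh : Tendsto (fun j => eLpNorm (fun x => grad (φ j) x - h x) (ENNReal.ofReal p)
      (volume.restrict D)) atTop (𝓝 0)) :
    eLpNorm v q (volume.restrict D) ≤ C * eLpNorm h (ENNReal.ofReal p) (volume.restrict D) := by
  have hp1 : (1 : ℝ≥0∞) ≤ ENNReal.ofReal p := by simpa using hp.le
  have hm : ∀ j, AEStronglyMeasurable (φ j) (volume.restrict D) := fun j =>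
    (hφ j).smooth.continuous.aestronglyMeasurable
  -- Convergence in `L^p` gives convergence in measure, along which the `L^q` norm is lower
  -- semicontinuous, also for `q = ∞`.
  have hmeas := tendstoInMeasure_of_tendsto_eLpNorm (one_pos.trans_le hp1).ne' hm hv hφv
  refine le_of_forall_gt fun c hc => ?_
  have hlim : Tendsto (fun j => (C : ℝ≥0∞) * (eLpNorm (fun x => grad (φ j) x - h x)
      (ENNReal.ofReal p) (volume.restrict D) + eLpNorm h (ENNReal.ofReal p) (volume.restrict D)))
      atTop (𝓝 (C * (0 + eLpNorm h (ENNReal.ofReal p) (volume.restrict D)))) :=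
    ENNReal.Tendsto.const_mul (hφh.add_const _) (Or.inr ENNReal.coe_ne_top)
  rw [zero_add] at hlim
  obtain ⟨c', hc', hcc'⟩ := exists_between hc
  refine lt_of_le_of_lt (eLpNorm_le_of_tendstoInMeasure ?_ hmeas hm) hcc'
  filter_upwards [hlim.eventually_lt_const hc'] with j hj
  refine ((hC _ (hφ j)).trans ?_).trans hj.le
  gcongr
  have := eLpNorm_add_le (((hφ j).continuous_grad.aestronglyMeasurable).sub hh) hh hp1
  rw [sub_add_cancel] at this
  exact this

lemma MemW0.eLpNorm_le {C : ℝ≥0} {q : ℝ≥0∞} {p : ℝ} (hC : SobolevBound C q p D) (hp : 1 < p)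
    {u : EuclideanSpace ℝ (Fin n) → ℂ} {g : EuclideanSpace ℝ (Fin n) → EuclideanSpace ℂ (Fin n)}
    (hu : MemW0 p D u g) :
    eLpNorm u q (volume.restrict D) ≤ C * eLpNorm g (ENNReal.ofReal p) (volume.restrict D) := by
  obtain ⟨ψ, hψ, h1, h2⟩ := hu.approx
  exact hC.le_of_tendsto hp hψ hu.memLp_fun.1 hu.memLp_grad.1 h1 h2

lemma SobolevBound.sobolevConst_le {C : ℝ≥0} {q : ℝ≥0∞} {p : ℝ} (hC : SobolevBound C q p D)
    (hp : 1 < p) : sobolevConst q p D ≤ C :=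
  iSup_le fun _ => iSup_le fun _ => iSup_le fun hu => iSup_le fun _ =>
    ENNReal.div_le_of_le_mul (hu.eLpNorm_le hC hp)

/-- The approximating test functions converge in `L^q` as well. -/
lemma MemW0.exists_approx {C : ℝ≥0} {q : ℝ≥0∞} {p : ℝ} (hC : SobolevBound C q p D) (hp : 1 < p)
    {u : EuclideanSpace ℝ (Fin n) → ℂ} {g : EuclideanSpace ℝ (Fin n) → EuclideanSpace ℂ (Fin n)}
    (hu : MemW0 p D u g) : ∃ ψ : ℕ → EuclideanSpace ℝ (Fin n) → ℂ, (∀ k, IsTestFunction D (ψ k)) ∧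
      Tendsto (fun k => eLpNorm (fun x => u x - ψ k x) q (volume.restrict D)) atTop (𝓝 0) ∧
      Tendsto (fun k => eLpNorm (fun x => g x - grad (ψ k) x) (ENNReal.ofReal p)
        (volume.restrict D)) atTop (𝓝 0) := by
  obtain ⟨ψ, hψ, h1, h2⟩ := hu.approx
  have h3 : Tendsto (fun k => eLpNorm (fun x => g x - grad (ψ k) x) (ENNReal.ofReal p)
        (volume.restrict D)) atTop (𝓝 0) := by
    refine h2.congr fun k => ?_
    exact eLpNorm_sub_comm (grad (ψ k)) g _ _
  refine ⟨ψ, hψ, ?_, h3⟩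
  have h4 : Tendsto (fun k => (C : ℝ≥0∞) * eLpNorm (fun x => g x - grad (ψ k) x)
      (ENNReal.ofReal p) (volume.restrict D)) atTop (𝓝 0) := by
    simpa using ENNReal.Tendsto.const_mul (a := (C : ℝ≥0∞)) h3 (Or.inr ENNReal.coe_ne_top)
  refine tendsto_of_tendsto_of_tendsto_of_le_of_le tendsto_const_nhds h4 (fun _ => zero_le)
    fun k => ?_
  -- With `k` fixed, `u - ψ k` is the limit of the test functions `ψ j - ψ k`.
  refine hC.le_of_tendsto hp (φ := fun j x => ψ j x - ψ k x) (fun j => (hψ j).sub (hψ k))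
    (hu.memLp_fun.1.sub (hψ k).smooth.continuous.aestronglyMeasurable)
    (hu.memLp_grad.1.sub (hψ k).continuous_grad.aestronglyMeasurable) ?_ ?_
  · simpa only [sub_sub_sub_cancel_right] using h1
  · refine h2.congr fun j => ?_
    congr 1
    ext1 x
    rw [grad_sub (hψ j).differentiable (hψ k).differentiable, sub_sub_sub_cancel_right]

/-! ### The energy estimate -/

lemma eLpNorm_mul_inner_le {g w : EuclideanSpace ℝ (Fin n) → EuclideanSpace ℂ (Fin n)}
    {μ : Measure (EuclideanSpace ℝ (Fin n))} {p : ℝ} (hp : 1 < p)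
    (hg : AEStronglyMeasurable g μ) (hw : AEStronglyMeasurable w μ) :
    eLpNorm (fun x => ((‖g x‖ ^ (p - 2) : ℝ) : ℂ) * inner ℂ (w x) (g x)) 1 μ
      ≤ eLpNorm g (ENNReal.ofReal p) μ ^ (p - 1) * eLpNorm w (ENNReal.ofReal p) μ := by
  have h1 : eLpNorm (fun x => ‖g x‖ ^ (p - 1) * ‖w x‖) 1 μ
      ≤ eLpNorm g (ENNReal.ofReal p) μ ^ (p - 1) * eLpNorm w (ENNReal.ofReal p) μ := by
    refine (eLpNorm_mul_le_of_inv (aestronglyMeasurable_norm_rpow hg _) hw.norm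
      (p := (ENNReal.ofReal (p - 1) * (ENNReal.ofReal p)⁻¹)⁻¹) (q := ENNReal.ofReal p) ?_).trans ?_
    · have hp0 : ENNReal.ofReal p ≠ 0 := by simp; linarith
      rw [inv_inv, inv_one, ← add_one_mul, ← ENNReal.ofReal_one,
        ← ENNReal.ofReal_add (by linarith) zero_le_one, sub_add_cancel, ENNReal.ofReal_one,
        ENNReal.mul_inv_cancel hp0 ENNReal.ofReal_ne_top]
    · rw [eLpNorm_norm]
      gcongr
      exact eLpNorm_norm_rpow_inv_le g (by linarith) _
  refine (eLpNorm_mono fun x => ?_).trans h1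
  -- Where `g` vanishes both sides are 0, whatever value `0^(p-2)` takes, because `p > 1`.
  have h2 : ‖g x‖ ^ (p - 2) * ‖g x‖ = ‖g x‖ ^ (p - 1) := by
    rcases (norm_nonneg (g x)).eq_or_lt with h | h
    · rw [← h, mul_zero, Real.zero_rpow (by linarith)]
    · rw [← Real.rpow_add_one h.ne']
      congr 1
      ring
  rw [norm_mul, Complex.norm_real, Real.norm_of_nonneg (by positivity),
    Real.norm_of_nonneg (by positivity), ← h2, mul_assoc, mul_comm ‖g x‖ ‖w x‖]
  gcongr
  exact norm_inner_le_norm _ _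

/-- The energy of a weak solution, tested against the conjugate of a test function. -/
lemma IsWeakSolution.energy_le {p : ℝ} (hp : 1 < p) (hDo : IsOpen D) {β γ : ℝ} (hβ : -1 ≤ β)
    (hγ : 0 ≤ γ) {r q : ℝ≥0∞} {V : EuclideanSpace ℝ (Fin n) → ℝ}
    (hV : AEStronglyMeasurable V (volume.restrict D))
    {f : EuclideanSpace ℝ (Fin n) → ℂ → EuclideanSpace ℂ (Fin n) → ℂ}
    (hf : ∀ x ∈ D, ∀ y z, ‖f x y z‖ ≤ ‖y‖ ^ (β + 1) * ‖z‖ ^ γ)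
    {u : EuclideanSpace ℝ (Fin n) → ℂ} {g : EuclideanSpace ℝ (Fin n) → EuclideanSpace ℂ (Fin n)}
    (hu : IsWeakSolution p D V f u g)
    (h : r⁻¹ + ENNReal.ofReal (β + 1) * q⁻¹ + ENNReal.ofReal γ * (ENNReal.ofReal p)⁻¹ + q⁻¹ = 1)
    {ψ : EuclideanSpace ℝ (Fin n) → ℂ} (hψ : IsTestFunction D ψ) :
    eLpNorm g (ENNReal.ofReal p) (volume.restrict D) ^ p ≤
      eLpNorm V r (volume.restrict D) * eLpNorm u q (volume.restrict D) ^ (β + 1)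
          * eLpNorm g (ENNReal.ofReal p) (volume.restrict D) ^ γ
          * eLpNorm ψ q (volume.restrict D)
        + eLpNorm g (ENNReal.ofReal p) (volume.restrict D) ^ (p - 1)
          * eLpNorm (fun x => g x - grad ψ x) (ENNReal.ofReal p) (volume.restrict D) := by
  set μ := volume.restrict D with hμ
  set P := ENNReal.ofReal p with hP
  have hg := hu.mem.memLp_grad
  have hψg : AEStronglyMeasurable (grad ψ) μ := hψ.continuous_grad.aestronglyMeasurable
  have hψm : AEStronglyMeasurable ψ μ := hψ.smooth.continuous.aestronglyMeasurable
  set T : (EuclideanSpace ℝ (Fin n) → EuclideanSpace ℂ (Fin n)) → EuclideanSpace ℝ (Fin n) → ℂ :=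
    fun w x => ((‖g x‖ ^ (p - 2) : ℝ) : ℂ) * inner ℂ (w x) (g x) with hT
  have hTm : ∀ w, AEStronglyMeasurable w μ → AEStronglyMeasurable (T w) μ := fun w hw =>
    (Complex.continuous_ofReal.comp_aestronglyMeasurable
      (aestronglyMeasurable_norm_rpow hg.1 (p - 2))).mul (hw.inner hg.1)
  have hTint : ∀ w, MemLp w P μ → Integrable (T w) μ := by
    intro w hw
    rw [← memLp_one_iff_integrable]
    refine ⟨hTm w hw.1, (eLpNorm_mul_inner_le hp hg.1 hw.1).trans_lt ?_⟩
    exact ENNReal.mul_lt_top (ENNReal.rpow_lt_top_of_nonneg (by linarith) hg.2.ne) hw.2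
  have hψP : MemLp (grad ψ) P μ := by
    have hcs : HasCompactSupport (grad ψ) := by
      refine hψ.compact.mono' fun x hx => ?_
      by_contra hxs
      apply hx
      have hf0 : fderiv ℝ ψ x = 0 := by
        by_contra h0
        exact hxs (support_fderiv_subset ℝ h0)
      ext i
      simp [grad, hf0]
    exact (hψ.continuous_grad.memLp_of_hasCompactSupport hcs).restrict D
  have hTg : ∀ x, T g x = ((‖g x‖ ^ p : ℝ) : ℂ) := by
    intro x
    have h2 : ‖g x‖ ^ (p - 2) * ‖g x‖ ^ 2 = ‖g x‖ ^ p := by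
      rcases (norm_nonneg (g x)).eq_or_lt with h | h
      · rw [← h, Real.zero_rpow (by linarith : p ≠ 0)]
        simp
      · rw [← Real.rpow_natCast, ← Real.rpow_add h]
        congr 1
        push_cast
        ring
    rw [hT, ← h2]
    simp only [inner_self_eq_norm_sq_to_K]
    push_cast
    rfl
  have hnorm : eLpNorm g P μ ^ p = ‖∫ x, T g x ∂μ‖ₑ := by
    have h1 : eLpNorm g P μ ^ p = ∫⁻ x, ‖T g x‖ₑ ∂μ := by
      rw [← eLpNorm_one_eq_lintegral_enorm]
      have h2 : eLpNorm (T g) 1 μ = eLpNorm (fun x => ‖g x‖ ^ p) 1 μ := by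
        refine eLpNorm_congr_norm_ae (Eventually.of_forall fun x => ?_)
        rw [hTg, Complex.norm_real]
      rw [h2, eLpNorm_norm_rpow _ (by linarith), one_mul]
    have h3 : ∫ x, T g x ∂μ = ((∫ x, ‖g x‖ ^ p ∂μ : ℝ) : ℂ) := by
      rw [← integral_complex_ofReal]
      exact integral_congr_ae (Eventually.of_forall hTg)
    have h4 : Integrable (fun x => ‖g x‖ ^ p) μ := by
      refine (hTint g hg).norm.congr (Eventually.of_forall fun x => ?_)
      simp only
      rw [hTg, Complex.norm_real, Real.norm_of_nonneg (by positivity)]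
    rw [h1, h3, ← ofReal_norm, Complex.norm_real,
      Real.norm_of_nonneg (integral_nonneg fun x => by positivity),
      ofReal_integral_eq_lintegral_ofReal h4 (Eventually.of_forall fun x => by positivity)]
    refine lintegral_congr fun x => ?_
    rw [hTg, ← ofReal_norm, Complex.norm_real, Real.norm_of_nonneg (by positivity)]
  -- `T` is additive in `w`: the equation handles `∇ψ`, and `g - ∇ψ` is the error.
  have hsplit : ∫ x, T g x ∂μ
      = ∫ x, T (grad ψ) x ∂μ + ∫ x, T (fun y => g y - grad ψ y) x ∂μ := by
    rw [← integral_add (hTint _ hψP) (hTint (fun y => g y - grad ψ y) (hg.sub hψP))]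
    refine integral_congr_ae (Eventually.of_forall fun x => ?_)
    simp only [hT, inner_sub_left]
    ring
  -- The equation's dot product is bilinear, so testing with the conjugate of `ψ` produces the
  -- Hermitian product in `T`.
  have heq : ∫ x, T (grad ψ) x ∂μ
      = ∫ x, (V x : ℂ) * f x (u x) (g x) * starRingEnd ℂ (ψ x) ∂μ := by
    rw [← hu.eqn _ hψ.conj]
    refine integral_congr_ae (Eventually.of_forall fun x => ?_)
    simp only [hT, PiLp.inner_apply, grad_conj ψ hψ.differentiable, RCLike.inner_apply]
  have hrhs : ‖∫ x, (V x : ℂ) * f x (u x) (g x) * starRingEnd ℂ (ψ x) ∂μ‖ₑ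
      ≤ eLpNorm V r μ * eLpNorm u q μ ^ (β + 1) * eLpNorm g P μ ^ γ * eLpNorm ψ q μ := by
    refine (enorm_integral_le_lintegral_enorm _).trans ?_
    rw [← eLpNorm_one_eq_lintegral_enorm]
    refine le_trans ?_ (eLpNorm_prod_le hV hu.mem.memLp_fun.1 hg.1 hψm (by linarith) hγ h)
    refine eLpNorm_mono_ae ?_
    filter_upwards [ae_restrict_mem hDo.measurableSet] with x hx
    rw [norm_mul, norm_mul, Complex.norm_real, RCLike.norm_conj,
      Real.norm_of_nonneg (by positivity : 0 ≤ ‖V x‖ * ‖u x‖ ^ (β + 1) * ‖g x‖ ^ γ * ‖ψ x‖),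
      mul_assoc ‖V x‖ (‖u x‖ ^ (β + 1))]
    gcongr
    exact hf x hx _ _
  have herr : ‖∫ x, T (fun y => g y - grad ψ y) x ∂μ‖ₑ
      ≤ eLpNorm g P μ ^ (p - 1) * eLpNorm (fun x => g x - grad ψ x) P μ := by
    refine (enorm_integral_le_lintegral_enorm _).trans ?_
    rw [← eLpNorm_one_eq_lintegral_enorm]
    exact eLpNorm_mul_inner_le hp hg.1 (hg.1.sub hψg)
  rw [hnorm, hsplit, heq]
  refine (enorm_add_le _ _).trans ?_
  gcongr

/-! ### The lower bound -/

/-- Here `a = ‖∇u‖_p`, `b = ‖u‖_q`, `v = ‖V‖_r`. Divide by `a^γ`, bound `b^(p-γ)` by `(K a)^(p-γ)`,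
which uses `γ ≤ p`, and divide by `b^(p-γ)`. -/
lemma one_le_of_energy_le {a b v K : ℝ≥0∞} {p β γ : ℝ} (hγp : γ ≤ p)
    (ha0 : a ≠ 0) (ha : a ≠ ⊤) (hb0 : b ≠ 0) (hb : b ≠ ⊤) (hbK : b ≤ K * a)
    (h : a ^ p ≤ v * b ^ (β + 1) * a ^ γ * b) :
    1 ≤ K ^ (p - γ) * v * b ^ (2 + β - p + γ) := by
  have hpg : 0 ≤ p - γ := by linarith
  have h1 : a ^ (p - γ) ≤ v * b ^ (β + 2) := by
    have e1 : a ^ p = a ^ (p - γ) * a ^ γ := by rw [← ENNReal.rpow_add _ _ ha0 ha, sub_add_cancel]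
    have e2 : b ^ (β + 2) = b ^ (β + 1) * b := by
      rw [show β + 2 = β + 1 + 1 by ring, ENNReal.rpow_add _ _ hb0 hb, ENNReal.rpow_one]
    rw [e1, mul_right_comm, mul_assoc v, ← e2] at h
    have h0 : a ^ γ ≠ 0 := by simp [ENNReal.rpow_eq_zero_iff, ha0, ha]
    exact (ENNReal.mul_le_mul_iff_left h0 (ENNReal.rpow_ne_top_of_ne_zero ha0 ha)).1 h
  have h2 : b ^ (p - γ) ≤ K ^ (p - γ) * (v * b ^ (β + 2)) := by
    refine (ENNReal.rpow_le_rpow hbK hpg).trans ?_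
    rw [ENNReal.mul_rpow_of_nonneg _ _ hpg]
    gcongr
  calc (1 : ℝ≥0∞) = b ^ (p - γ) * b ^ (-(p - γ)) := by
        rw [← ENNReal.rpow_add _ _ hb0 hb, add_neg_cancel, ENNReal.rpow_zero]
    _ ≤ K ^ (p - γ) * (v * b ^ (β + 2)) * b ^ (-(p - γ)) := by gcongr
    _ = K ^ (p - γ) * v * b ^ (2 + β - p + γ) := by
        rw [show 2 + β - p + γ = (β + 2) + -(p - γ) by ring,
          ENNReal.rpow_add (β + 2) (-(p - γ)) hb0 hb]
        simp only [mul_assoc]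

/-- All regimes at once: any finite `C` supplies finiteness and the approximation, while the final
bound uses the sharp constant. -/
theorem IsWeakSolution.one_le {C : ℝ≥0} {p : ℝ} (hp : 1 < p) (hDo : IsOpen D) {β γ : ℝ}
    (hβ : -1 ≤ β) (hγ : 0 ≤ γ) {r q : ℝ≥0∞} (hr : 1 ≤ r) (hq : q ≠ 0)
    (hC : SobolevBound C q p D) {V : EuclideanSpace ℝ (Fin n) → ℝ}
    (hV : MemLp V r (volume.restrict D))
    {f : EuclideanSpace ℝ (Fin n) → ℂ → EuclideanSpace ℂ (Fin n) → ℂ}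
    (hf : ∀ x ∈ D, ∀ y z, ‖f x y z‖ ≤ ‖y‖ ^ (β + 1) * ‖z‖ ^ γ)
    {u : EuclideanSpace ℝ (Fin n) → ℂ} {g : EuclideanSpace ℝ (Fin n) → EuclideanSpace ℂ (Fin n)}
    (hu : IsWeakSolution p D V f u g) (hu0 : Nontriv D u)
    (h : (r⁻¹).toReal + (β + 2) * (q⁻¹).toReal + γ / p = 1) :
    sobolevConst q p D < ⊤ ∧ MemLp u q (volume.restrict D) ∧
      1 ≤ sobolevConst q p D ^ (p - γ) * eLpNorm V r (volume.restrict D)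
        * eLpNorm u q (volume.restrict D) ^ (2 + β - p + γ) := by
  have hp0 : 0 < p := by linarith
  have hle := hu.mem.eLpNorm_le hC hp
  have hgfin := hu.mem.memLp_grad.2
  have hufin : eLpNorm u q (volume.restrict D) < ⊤ :=
    hle.trans_lt (ENNReal.mul_lt_top ENNReal.coe_lt_top hgfin)
  refine ⟨(hC.sobolevConst_le hp).trans_lt ENNReal.coe_lt_top, ⟨hu.mem.memLp_fun.1, hufin⟩, ?_⟩
  have hub : eLpNorm u q (volume.restrict D) ≠ 0 := fun h0 =>
    hu0 ((eLpNorm_eq_zero_iff hu.mem.memLp_fun.1 hq).1 h0)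
  have hg0 : eLpNorm g (ENNReal.ofReal p) (volume.restrict D) ≠ 0 := by
    intro h0
    rw [h0, mul_zero] at hle
    exact hub (le_antisymm hle zero_le)
  -- The other two terms of the exponent relation are nonnegative, so `γ/p ≤ 1`.
  have hγp : γ ≤ p := by
    rw [← div_le_one hp0, ← h, le_add_iff_nonneg_left]
    have : 0 ≤ β + 2 := by linarith
    positivity
  -- `β + 2` is split as `(β + 1) + 1`: the extra `1/q` belongs to the test function.
  have hexp : r⁻¹ + ENNReal.ofReal (β + 1) * q⁻¹ + ENNReal.ofReal γ * (ENNReal.ofReal p)⁻¹ + q⁻¹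
      = 1 := by
    have hr' : r⁻¹ ≠ ⊤ := by simpa using (one_pos.trans_le hr).ne'
    have hq' : q⁻¹ ≠ ⊤ := by simpa using hq
    have hβ1 : 0 ≤ β + 1 := by linarith
    rw [← ENNReal.ofReal_toReal hr', ← ENNReal.ofReal_toReal hq', ← ENNReal.ofReal_inv_of_pos hp0,
      ← ENNReal.ofReal_mul hβ1, ← ENNReal.ofReal_mul hγ, ← ENNReal.ofReal_add (by positivity)
      (by positivity), ← ENNReal.ofReal_add (by positivity) (by positivity),
      ← ENNReal.ofReal_add (by positivity) (by positivity), ENNReal.ofReal_eq_one]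
    linear_combination h
  obtain ⟨ψ, hψ, hψ1, hψ2⟩ := hu.mem.exists_approx hC hp
  have hlim : eLpNorm g (ENNReal.ofReal p) (volume.restrict D) ^ p ≤
      eLpNorm V r (volume.restrict D) * eLpNorm u q (volume.restrict D) ^ (β + 1)
        * eLpNorm g (ENNReal.ofReal p) (volume.restrict D) ^ γ
        * eLpNorm u q (volume.restrict D) := by
    set M := eLpNorm V r (volume.restrict D) * eLpNorm u q (volume.restrict D) ^ (β + 1)
        * eLpNorm g (ENNReal.ofReal p) (volume.restrict D) ^ γ with hM
    set G := eLpNorm g (ENNReal.ofReal p) (volume.restrict D) ^ (p - 1) with hG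
    have hMt : M ≠ ⊤ := ENNReal.mul_ne_top (ENNReal.mul_ne_top hV.2.ne
      (ENNReal.rpow_ne_top_of_nonneg (by linarith) hufin.ne))
      (ENNReal.rpow_ne_top_of_nonneg hγ hgfin.ne)
    have hGt : G ≠ ⊤ := ENNReal.rpow_ne_top_of_nonneg (by linarith) hgfin.ne
    have hq1 : 1 ≤ q := by
      rw [← ENNReal.inv_le_one, ← hexp]
      exact le_add_self
    have ht : Tendsto (fun k => M * (eLpNorm u q (volume.restrict D)
          + eLpNorm (fun x => u x - ψ k x) q (volume.restrict D))
        + G * eLpNorm (fun x => g x - grad (ψ k) x) (ENNReal.ofReal p) (volume.restrict D)) atTop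
        (𝓝 (M * (eLpNorm u q (volume.restrict D) + 0) + G * 0)) :=
      (ENNReal.Tendsto.const_mul (hψ1.const_add _) (Or.inr hMt)).add
        (ENNReal.Tendsto.const_mul hψ2 (Or.inr hGt))
    rw [add_zero, mul_zero, add_zero] at ht
    refine ge_of_tendsto' ht fun k => ?_
    refine (hu.energy_le hp hDo hβ hγ hV.1 hf hexp (hψ k)).trans ?_
    gcongr
    have hψm : AEStronglyMeasurable (ψ k) (volume.restrict D) :=
      (hψ k).smooth.continuous.aestronglyMeasurable
    have := eLpNorm_sub_le hu.mem.memLp_fun.1 (hu.mem.memLp_fun.1.sub hψm) hq1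
    rw [sub_sub_cancel] at this
    exact this
  refine one_le_of_energy_le hγp hg0 hgfin.ne hub hufin.ne ?_ hlim
  -- `u` itself competes in the supremum defining the Sobolev constant.
  rw [← ENNReal.div_le_iff hg0 hgfin.ne]
  exact le_iSup_of_le u (le_iSup_of_le g (le_iSup_of_le hu.mem (le_iSup_of_le hu0 le_rfl)))

end PLap

theorem theorem4p2 (n : ℕ) (hn : 1 ≤ n)
    (D : Set (EuclideanSpace ℝ (Fin n))) (hDo : IsOpen D) (hDb : Bornology.IsBounded D)
    (p : ℝ) (hp : 1 < p) (β γ : ℝ) (hβ : -1 ≤ β) (hγ : 0 ≤ γ)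
    (r : ℝ≥0∞) (hr : 1 ≤ r)
    (V : EuclideanSpace ℝ (Fin n) → ℝ) (hV : MemLp V r (volume.restrict D))
    (f : EuclideanSpace ℝ (Fin n) → ℂ → EuclideanSpace ℂ (Fin n) → ℂ)
    (hf : ∀ x ∈ D, ∀ y z, ‖f x y z‖ ≤ ‖y‖ ^ (β + 1) * ‖z‖ ^ γ)
    (u : EuclideanSpace ℝ (Fin n) → ℂ)
    (g : EuclideanSpace ℝ (Fin n) → EuclideanSpace ℂ (Fin n))
    (hu : PLap.IsWeakSolution p D V f u g) (hu0 : PLap.Nontriv D u) :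
    (p ≠ n →
      (r⁻¹).toReal + (β + 2) * ((PLap.qBar n p)⁻¹).toReal + γ / p = 1 →
        PLap.sobolevConst (PLap.qBar n p) p D < ⊤ ∧
        MemLp u (PLap.qBar n p) (volume.restrict D) ∧
        1 ≤ PLap.sobolevConst (PLap.qBar n p) p D ^ (p - γ)
            * eLpNorm V r (volume.restrict D)
            * eLpNorm u (PLap.qBar n p) (volume.restrict D) ^ (2 + β - p + γ)) ∧
    (p = n → ∀ q : ℝ≥0∞, 1 ≤ q → q < ⊤ →
      (r⁻¹).toReal + (β + 2) * (q⁻¹).toReal + γ / p = 1 →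
        PLap.sobolevConst q p D < ⊤ ∧
        MemLp u q (volume.restrict D) ∧
        1 ≤ PLap.sobolevConst q p D ^ (p - γ)
            * eLpNorm V r (volume.restrict D)
            * eLpNorm u q (volume.restrict D) ^ (2 + β - p + γ)) := by

  refine ⟨fun hpn h => ?_, fun hpn q hq hq' h => ?_⟩
  · rcases lt_or_gt_of_ne hpn with hlt | hgt
    · obtain ⟨C, hC⟩ := PLap.exists_sobolevBound_of_lt (D := D) hp hlt
      have hq : PLap.qBar n p = ENNReal.ofReal (n * p / (n - p)) := if_pos hlt
      rw [hq] at h ⊢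
      refine hu.one_le hp hDo hβ hγ hr ?_ hC hV hf hu0 h
      have h1 : 0 < (n : ℝ) - p := by linarith
      have h2 : (0 : ℝ) < n := by linarith
      exact (ENNReal.ofReal_pos.2 (by positivity)).ne'
    · obtain ⟨C, hC⟩ := PLap.exists_sobolevBound_of_gt hDb hn hgt
      have hq : PLap.qBar n p = ⊤ := if_neg hgt.not_gt
      rw [hq] at h ⊢
      exact hu.one_le hp hDo hβ hγ hr ENNReal.top_ne_zero hC hV hf hu0 h
  · subst hpn
    obtain ⟨C, hC⟩ := PLap.exists_sobolevBound_of_eq hDb (by exact_mod_cast hp) hq hq'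
    exact hu.one_le hp hDo hβ hγ hr (one_pos.trans_le hq).ne' hC hV hf hu0 h
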